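/- Let $\mu_0,\mu_1$ be Borel probability measures on $\mathbb{R}^d$ with compact supports $\operatorname{spt}\mu_0,\operatorname{spt}\mu_1$, and let $c_0,c_1:\mathbb{R}^d\times\mathbb{R}^d\to[0,\infty)$ be continuous. For Borel probability measures $\rho,\sigma$ on $\mathbb{R}^d$ let $\Pi(\rho,\sigma)$ be the set of probability measures on $\mathbb{R}^d\times\mathbb{R}^d$ with marginals $\rho,\sigma$, and for a cost $b:\mathbb{R}^d\times\mathbb{R}^d\to[0,\infty)$ let $W_b(\rho,\sigma)=\inf_{\gamma\in\Pi(\rho,\sigma)}\int b\,d\gamma\in[0,\infty]$; a minimizing $\gamma$ is called a $b$-optimal plan. For a set $\mathcal{A}$ of probability measures on $\mathbb{R}^d$ consider the interpolation problem $$\inf\{W_{c_0}(\mu_0,\mu)+W_{c_1}(\mu,\mu_1)\ :\ \mu\in\mathcal{A}\}.\tag{1}$$ Let $K\subset\mathbb{R}^d$ be compact, and assume one of the following. (a) (No constraint.) $\mathcal{A}=\mathcal{P}(\mathbb{R}^d)$ is the set of all Borel probability measures on $\mathbb{R}^d$; for every $(x_0,x_1)\in\operatorname{spt}\mu_0\times\operatorname{spt}\mu_1$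 the set $\operatorname{argmin}_{x\in\mathbb{R}^d}\{c_0(x_0,x)+c_1(x,x_1)\}$ is nonempty and contained in $K$; and $c(x_0,x_1)=\inf_{x\in\mathbb{R}^d}\{c_0(x_0,x)+c_1(x,x_1)\}$ (a minimum, attained in $K$, on $\operatorname{spt}\mu_0\times\operatorname{spt}\mu_1$). (b) (Location constraint.) $K\neq\emptyset$; $\mathcal{A}=\mathcal{P}(K)$ is the set of Borel probability measures on $\mathbb{R}^d$ concentrated on $K$; and $c(x_0,x_1)=\min_{x\in K}\{c_0(x_0,x)+c_1(x,x_1)\}$. Then the following hold. 1. The value of (1) equals $W_c(\mu_0,\mu_1)$, and both infima are attained. 2. If $\gamma\in\Pi(\mu_0,\mu_1)$ is $c$-optimal and $T:\operatorname{spt}\mu_0\times\operatorname{spt}\mu_1\to\mathbb{R}^d$ is measurable with $T(x_0,x_1)\in\operatorname{argmin}_{x\in K}\{c_0(x_0,x)+c_1(x,x_1)\}$ for all $(x_0,x_1)\in\operatorname{spt}\mu_0\times\operatorname{spt}\mu_1$, then the image measure $T^\#\gamma$ is a solution of (1). 3. Conversely, let $\mu$ be any solution of (1). Then $\operatorname{spt}\mu\subset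 K$, there exist a $c_0$-optimal plan in $\Pi(\mu_0,\mu)$ and a $c_1$-optimal plan in $\Pi(\mu,\mu_1)$, and for any such plans $\gamma_0$ and $\gamma_1$ there is a probability measure $\tilde\gamma$ on $\mathbb{R}^d\times\mathbb{R}^d\times\mathbb{R}^d$ (variables $(x_0,x,x_1)$) with marginals $\mu_0,\mu,\mu_1$, whose $(x_0,x)$-marginal is $\gamma_0$ and whose $(x,x_1)$-marginal is $\gamma_1$, such that its $(x_0,x_1)$-marginal is a $c$-optimal plan in $\Pi(\mu_0,\mu_1)$ and $c_0(x_0,x)+c_1(x,x_1)=c(x_0,x_1)$ for all $(x_0,x,x_1)\in\operatorname{spt}\tilde\gamma$. -/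

import Mathlib

open MeasureTheory Set
open scoped NNReal ENNReal

namespace ConstrainedInterpolation

/-- `Π(ρ, σ)`: the transport plans between `ρ` and `σ`. -/
def plans {X : Type*} [MeasurableSpace X] (ρ σ : Measure X) : Set (Measure (X × X)) :=
  {γ | IsProbabilityMeasure γ ∧ γ.map Prod.fst = ρ ∧ γ.map Prod.snd = σ}

/-- `Π(μ₀, μ, μ₁)`: the transport plans in the variables `(x₀, x, x₁)` with marginals
`μ₀`, `μ`, `μ₁`. -/
def plans₃ {X : Type*} [MeasurableSpace X] (μ₀ μ μ₁ : Measure X) : Set (Measure (X × X × X)) :=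
  {γ | IsProbabilityMeasure γ ∧ γ.map (fun p => p.1) = μ₀ ∧ γ.map (fun p => p.2.1) = μ ∧
    γ.map (fun p => p.2.2) = μ₁}

/-- `W_c(ρ, σ)`: the value of the optimal transport problem with cost `c ≥ 0`. It may be `∞`. -/
noncomputable def transportValue {X : Type*} [MeasurableSpace X] (c : X × X → ℝ≥0)
    (ρ σ : Measure X) : ℝ≥0∞ :=
  ⨅ γ ∈ plans ρ σ, ∫⁻ p, (c p : ℝ≥0∞) ∂γ

/-- `γ` is an optimal transport plan between `ρ` and `σ` for the cost `c`. -/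
def IsOptimalPlan {X : Type*} [MeasurableSpace X] (c : X × X → ℝ≥0) (ρ σ : Measure X)
    (γ : Measure (X × X)) : Prop :=
  γ ∈ plans ρ σ ∧ ∫⁻ p, (c p : ℝ≥0∞) ∂γ = transportValue c ρ σ

/-- `𝒫(X)`: all probability measures on `X`. -/
def probs (X : Type*) [MeasurableSpace X] : Set (Measure X) :=
  {μ | IsProbabilityMeasure μ}

/-- `𝒫(K)`: the probability measures on `X` that are concentrated on `K`. -/
def probsOn {X : Type*} [MeasurableSpace X] (K : Set X) : Set (Measure X) :=
  {μ | IsProbabilityMeasure μ ∧ μ Kᶜ = 0}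

/-- The functional `μ ↦ W_{c₀}(μ₀, μ) + W_{c₁}(μ, μ₁)`. -/
noncomputable def interpolationCost {X : Type*} [MeasurableSpace X] (c₀ c₁ : X × X → ℝ≥0)
    (μ₀ μ₁ μ : Measure X) : ℝ≥0∞ :=
  transportValue c₀ μ₀ μ + transportValue c₁ μ μ₁

/-- The value of the interpolation problem over the admissible class `A`. -/
noncomputable def interpolationValue {X : Type*} [MeasurableSpace X] (c₀ c₁ : X × X → ℝ≥0)
    (μ₀ μ₁ : Measure X) (A : Set (Measure X)) : ℝ≥0∞ :=
  ⨅ μ ∈ A, interpolationCost c₀ c₁ μ₀ μ₁ μ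

/-- `μ` solves the interpolation problem over the admissible class `A`. -/
def IsInterpolant {X : Type*} [MeasurableSpace X] (c₀ c₁ : X × X → ℝ≥0)
    (μ₀ μ₁ : Measure X) (A : Set (Measure X)) (μ : Measure X) : Prop :=
  μ ∈ A ∧ interpolationCost c₀ c₁ μ₀ μ₁ μ = interpolationValue c₀ c₁ μ₀ μ₁ A

/-- `argmin_{x ∈ S} {c₀(x₀, x) + c₁(x, x₁)}`. -/
def midArgmin {X : Type*} (c₀ c₁ : X × X → ℝ≥0) (S : Set X) (x₀ x₁ : X) : Set X :=
  {x | x ∈ S ∧ IsMinOn (fun y => c₀ (x₀, y) + c₁ (y, x₁)) S x}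

/-- The cost `c(x₀, x₁) = inf_{x ∈ S} {c₀(x₀, x) + c₁(x, x₁)}` (used for nonempty `S`). -/
noncomputable def midCost {X : Type*} (c₀ c₁ : X × X → ℝ≥0) (S : Set X) (p : X × X) : ℝ≥0 :=
  ⨅ x : S, (c₀ (p.1, (x : X)) + c₁ ((x : X), p.2))

/-- `T^# γ` for a map `T` that is only defined on a set `D` carrying `γ`. -/
noncomputable def pushforwardOn {Y X : Type*} [MeasurableSpace Y] [MeasurableSpace X] {D : Set Y}
    (T : D → X) (γ : Measure Y) : Measure X :=
  (γ.comap (Subtype.val : D → Y)).map T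

end ConstrainedInterpolation

namespace ConstrainedInterpolation

/-! Gluing optimal plans along an admissible `μ` gives a measure on triples against which `c₀ + c₁`
integrates to the functional at `μ`. Since `c ≤ c₀ + c₁`, its endpoint marginal shows that the
functional is at least `W_c`. Conversely, a measurable choice of minimizing midpoints pushes a
`c`-optimal plan to a measure achieving `W_c`. If `μ` is a solution, the lower bound is an equality
between finite integrals, so `c = c₀ + c₁` almost everywhere, hence on the support by continuity.

Both cases come from `interpolation_probsOn`: the constraint set `S` is closed, contains `K`, and
its minimizers lie in `K`; then `S` is the whole space or `K`. The cost over `S` is traded for the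
cost over the compact `K`, which is continuous and agrees with it on the product of the supports,
where every plan is concentrated. -/

theorem lowerSemicontinuous_lintegral_coe {Ω : Type*} [TopologicalSpace Ω] [MeasurableSpace Ω]
    [OpensMeasurableSpace Ω] {b : Ω → ℝ≥0} (hb : Continuous b) :
    LowerSemicontinuous fun μ : ProbabilityMeasure Ω => ∫⁻ x, (b x : ℝ≥0∞) ∂(μ : Measure Ω) := by
  -- Truncations are bounded, so weak convergence applies to them; by monotone convergence the
  -- integral is their supremum.
  have hcont (n : ℕ) : Continuous fun μ : ProbabilityMeasure Ω =>
      ∫⁻ x, ((min (b x) n : ℝ≥0) : ℝ≥0∞) ∂(μ : Measure Ω) := by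
    refine ProbabilityMeasure.continuous_lintegral_boundedContinuousFunction
      (BoundedContinuousFunction.mkOfBound ⟨fun x => min (b x) n, by fun_prop⟩ n ?_)
    intro x y
    have hx : ((min (b x) n : ℝ≥0) : ℝ) ≤ n := by exact_mod_cast min_le_right (b x) (n : ℝ≥0)
    have hy : ((min (b y) n : ℝ≥0) : ℝ) ≤ n := by exact_mod_cast min_le_right (b y) (n : ℝ≥0)
    have hx' := (min (b x) n : ℝ≥0).coe_nonneg
    have hy' := (min (b y) n : ℝ≥0).coe_nonneg
    rw [NNReal.dist_eq, abs_le]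
    constructor <;> simp only [ContinuousMap.coe_mk] <;> linarith
  have hsup (μ : ProbabilityMeasure Ω) : ∫⁻ x, (b x : ℝ≥0∞) ∂(μ : Measure Ω)
      = ⨆ n : ℕ, ∫⁻ x, ((min (b x) n : ℝ≥0) : ℝ≥0∞) ∂(μ : Measure Ω) := by
    rw [← lintegral_iSup]
    · refine lintegral_congr fun x => le_antisymm ?_ ?_
      · obtain ⟨n, hn⟩ := exists_nat_ge (b x)
        refine le_iSup_of_le n ?_
        rw [min_eq_left hn]
      · exact iSup_le fun n => by exact_mod_cast min_le_left _ _
    · intro n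
      exact (by fun_prop : Continuous fun x => min (b x) (n : ℝ≥0)).measurable.coe_nnreal_ennreal
    · intro m n hmn x
      dsimp only
      gcongr
  simp_rw [hsup]
  exact lowerSemicontinuous_iSup fun n => (hcont n).lowerSemicontinuous

/-- Measurable selection of minimizers over a compact metrizable space: parametrize the space by the
Cantor set and pick the least minimizing parameter, which is lower semicontinuous. -/
theorem exists_measurable_forall_le {X Y : Type*} [TopologicalSpace X] [MeasurableSpace X]
    [OpensMeasurableSpace X] [TopologicalSpace Y] [CompactSpace Y]
    [TopologicalSpace.MetrizableSpace Y] [Nonempty Y] [MeasurableSpace Y] [BorelSpace Y]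
    {F : X × Y → ℝ≥0} (hF : Continuous F) :
    ∃ T : X → Y, Measurable T ∧ ∀ x y, F (x, T x) ≤ F (x, y) := by
  let _ := TopologicalSpace.metrizableSpaceMetric Y
  obtain ⟨φ₀, hφ₀, hφ₀s⟩ := exists_nat_bool_continuous_surjective_of_compact Y
  have : CompactSpace cantorSet := isCompact_iff_compactSpace.mp isCompact_cantorSet
  set φ : cantorSet → Y := φ₀ ∘ cantorSetHomeomorphNatToBool with hφdef
  have hφ : Continuous φ := hφ₀.comp (Homeomorph.continuous _)
  have hφs : Function.Surjective φ := hφ₀s.comp (Homeomorph.surjective _)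
  set A : Set (X × cantorSet) := {p | ∀ y, F (p.1, φ p.2) ≤ F (p.1, y)} with hAdef
  have hA : IsClosed A := by
    simp only [hAdef, ofPred_forall]
    exact isClosed_iInter fun y => isClosed_le (by fun_prop) (by fun_prop)
  have hne (x : X) : {t | (x, t) ∈ A}.Nonempty := by
    obtain ⟨y, -, hy⟩ := isCompact_univ.exists_isMinOn (univ_nonempty (α := Y))
      (by fun_prop : Continuous fun y => F (x, y)).continuousOn
    obtain ⟨t, rfl⟩ := hφs y
    exact ⟨t, fun z => hy (mem_univ z)⟩
  have hleast (x : X) : ∃ t, IsLeast {t | (x, t) ∈ A} t :=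
    (hA.preimage (by fun_prop : Continuous fun t : cantorSet => (x, t))).isCompact.exists_isLeast
      (hne x)
  choose g hg using hleast
  have hgm : Measurable fun x => (g x : ℝ) := by
    refine measurable_of_Iic fun a => IsClosed.measurableSet ?_
    -- The least parameter is at most `a` iff some minimizing one is. Projection along a compact
    -- factor keeps this set closed.
    have : (fun x => (g x : ℝ)) ⁻¹' Iic a = Prod.fst '' (A ∩ {p | (p.2 : ℝ) ≤ a}) := by
      ext x
      constructor
      · exact fun h => ⟨(x, g x), ⟨(hg x).1, h⟩, rfl⟩
      · rintro ⟨⟨x, t⟩, ⟨h1, h2⟩, rfl⟩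
        exact le_trans (Subtype.coe_le_coe.mpr ((hg x).2 h1)) h2
    rw [this]
    exact isClosedMap_fst_of_compactSpace _
      (hA.inter (isClosed_le (by fun_prop) continuous_const))
  exact ⟨φ ∘ g, hφ.measurable.comp (hgm.subtype_mk (h := fun x => (g x).2)), fun x y => (hg x).1 y⟩

/-! ### Transport plans: gluing, compactness and existence of optimal plans -/

section Plans

variable {X : Type*} [MeasurableSpace X] {ρ σ τ : Measure X} {γ : Measure (X × X)}

/-- Gluing of two plans along their common marginal. -/
theorem exists_glued_plan [StandardBorelSpace X] {γ₀ γ₁ : Measure (X × X)}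
    (h₀ : γ₀ ∈ plans ρ σ) (h₁ : γ₁ ∈ plans σ τ) :
    ∃ γ ∈ plans₃ ρ σ τ, γ.map (fun p => (p.1, p.2.1)) = γ₀ ∧
      γ.map (fun p => (p.2.1, p.2.2)) = γ₁ := by
  obtain ⟨hp₀, hρ, hσ⟩ := h₀
  obtain ⟨hp₁, hσ', hτ⟩ := h₁
  obtain ⟨x₀⟩ : Nonempty X := ((nonempty_of_isProbabilityMeasure γ₀).map Prod.fst)
  have : Nonempty X := ⟨x₀⟩
  -- Given `(x₀, x)`, the third variable is drawn from the disintegration of `γ₁` at `x`,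
  -- independently of `x₀`.
  set κ := γ₁.condKernel.comap (Prod.snd : X × X → X) measurable_snd with hκ
  set γ := (γ₀.compProd κ).map (fun q : (X × X) × X => (q.1.1, q.1.2, q.2)) with hγ
  have e₀ : γ.map (fun p => (p.1, p.2.1)) = γ₀ := by
    rw [hγ, Measure.map_map (by fun_prop) (by fun_prop)]
    exact Measure.fst_compProd γ₀ κ
  have e₁ : γ.map (fun p => (p.2.1, p.2.2)) = γ₁ := by
    rw [hγ, Measure.map_map (by fun_prop) (by fun_prop)]
    refine Measure.ext_of_lintegral _ fun f hf => ?_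
    rw [lintegral_map hf (by fun_prop), Measure.lintegral_compProd (by fun_prop)]
    conv_rhs => rw [← γ₁.disintegrate γ₁.condKernel, Measure.lintegral_compProd hf]
    have hfst : γ₁.fst = γ₀.map Prod.snd := by rw [hσ]; exact hσ'
    rw [hfst, lintegral_map (hf.lintegral_kernel_prod_right') measurable_snd]
    rfl
  refine ⟨γ, ⟨Measure.isProbabilityMeasure_map (by fun_prop), ?_, ?_, ?_⟩, e₀, e₁⟩
  · rw [← hρ, ← e₀]; exact (Measure.map_map (f := fun p : X × X × X =>
      (p.1, p.2.1)) measurable_fst (by fun_prop)).symm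
  · rw [← hσ, ← e₀]; exact (Measure.map_map (f := fun p : X × X × X =>
      (p.1, p.2.1)) measurable_snd (by fun_prop)).symm
  · rw [← hτ, ← e₁]; exact (Measure.map_map (by fun_prop) (by fun_prop)).symm

theorem map_mem_plans_of_mem_plans₃ {γ : Measure (X × X × X)} (hγ : γ ∈ plans₃ ρ σ τ) :
    γ.map (fun p => (p.1, p.2.2)) ∈ plans ρ τ := by
  obtain ⟨hp, h₀, -, h₁⟩ := hγ
  refine ⟨Measure.isProbabilityMeasure_map (by fun_prop), ?_, ?_⟩
  · rw [Measure.map_map measurable_fst (by fun_prop), ← h₀]; rfl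
  · rw [Measure.map_map measurable_snd (by fun_prop), ← h₁]; rfl

theorem probsOn_univ : probsOn (univ : Set X) = probs X := by
  simp [probsOn, probs]

theorem prod_mem_plans [IsProbabilityMeasure ρ] [IsProbabilityMeasure σ] :
    ρ.prod σ ∈ plans ρ σ :=
  ⟨inferInstance, Measure.map_fst_prod.trans (by simp), Measure.map_snd_prod.trans (by simp)⟩

/-- Allows a possibly discontinuous cost to be replaced by a continuous one with the same values on
the supports. -/
theorem transportValue_congr {b c : X × X → ℝ≥0} (h : ∀ γ ∈ plans ρ σ, b =ᵐ[γ] c) :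
    transportValue b ρ σ = transportValue c ρ σ := by
  refine iInf_congr fun γ => iInf_congr fun hγ => lintegral_congr_ae ?_
  filter_upwards [h γ hγ] with p hp
  rw [hp]

theorem isOptimalPlan_congr {b c : X × X → ℝ≥0} (h : ∀ γ ∈ plans ρ σ, b =ᵐ[γ] c) :
    IsOptimalPlan b ρ σ γ ↔ IsOptimalPlan c ρ σ γ := by
  refine and_congr_right fun hγ => ?_
  rw [transportValue_congr h, lintegral_congr_ae ((h γ hγ).mono fun p hp => by rw [hp])]

theorem transportValue_le {c : X × X → ℝ≥0} (hγ : γ ∈ plans ρ σ) :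
    transportValue c ρ σ ≤ ∫⁻ p, (c p : ℝ≥0∞) ∂γ :=
  iInf₂_le γ hγ

theorem isTightMeasureSet_plans [TopologicalSpace X] [PolishSpace X] [BorelSpace X]
    [IsProbabilityMeasure ρ] [IsProbabilityMeasure σ] : IsTightMeasureSet (plans ρ σ) := by
  rw [isTightMeasureSet_iff_exists_isCompact_measure_compl_le]
  intro ε hε
  have hε2 : 0 < ε / 2 := ENNReal.half_pos hε.ne'
  obtain ⟨A, hA, hρA⟩ := isTightMeasureSet_iff_exists_isCompact_measure_compl_le.1
    (isTightMeasureSet_singleton (μ := ρ)) _ hε2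
  obtain ⟨B, hB, hσB⟩ := isTightMeasureSet_iff_exists_isCompact_measure_compl_le.1
    (isTightMeasureSet_singleton (μ := σ)) _ hε2
  refine ⟨A ×ˢ B, hA.prod hB, ?_⟩
  rintro γ ⟨-, rfl, rfl⟩
  have hA' := hρA _ rfl
  have hB' := hσB _ rfl
  rw [Measure.map_apply measurable_fst hA.measurableSet.compl] at hA'
  rw [Measure.map_apply measurable_snd hB.measurableSet.compl] at hB'
  rw [compl_prod_eq_union, ← ENNReal.add_halves ε]
  refine (measure_union_le _ _).trans (add_le_add ?_ ?_)
  · exact (prod_univ (s := Aᶜ)).symm ▸ hA'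
  · exact (univ_prod (t := Bᶜ)).symm ▸ hB'

/-- Prokhorov's theorem: plans are tight because their marginals are, and fixing the marginals is a
closed condition. -/
theorem isCompact_setOf_mem_plans [TopologicalSpace X] [PolishSpace X] [BorelSpace X]
    [hρ : IsProbabilityMeasure ρ] [hσ : IsProbabilityMeasure σ] :
    IsCompact {γ : ProbabilityMeasure (X × X) | (γ : Measure (X × X)) ∈ plans ρ σ} := by
  let _ := TopologicalSpace.upgradeIsCompletelyMetrizable X
  have heq (ν : ProbabilityMeasure X) (τ : Measure X) (hτ : IsProbabilityMeasure τ) :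
      (ν : Measure X) = τ ↔ ν = ⟨τ, hτ⟩ := ⟨fun h => Subtype.ext h, fun h => congrArg _ h⟩
  have hclosed :
      IsClosed {γ : ProbabilityMeasure (X × X) | (γ : Measure (X × X)) ∈ plans ρ σ} := by
    have : {γ : ProbabilityMeasure (X × X) | (γ : Measure (X × X)) ∈ plans ρ σ}
        = {γ | γ.map measurable_fst.aemeasurable = ⟨ρ, hρ⟩} ∩
          {γ | γ.map measurable_snd.aemeasurable = ⟨σ, hσ⟩} := by
      ext γ
      simp only [plans, mem_ofPred_eq, mem_inter_iff]
      rw [← heq, ← heq, ProbabilityMeasure.toMeasure_map, ProbabilityMeasure.toMeasure_map]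
      exact and_iff_right γ.2
    rw [this]
    exact (isClosed_singleton.preimage (ProbabilityMeasure.continuous_map continuous_fst)).inter
      (isClosed_singleton.preimage (ProbabilityMeasure.continuous_map continuous_snd))
  rw [← hclosed.closure_eq]
  refine isCompact_closure_of_isTightMeasureSet
    ((isTightMeasureSet_plans (ρ := ρ) (σ := σ)).subset ?_)
  rintro _ ⟨γ, hγ, rfl⟩
  exact hγ

theorem exists_isOptimalPlan [TopologicalSpace X] [PolishSpace X] [BorelSpace X]
    [IsProbabilityMeasure ρ] [IsProbabilityMeasure σ] {b : X × X → ℝ≥0} (hb : Continuous b) :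
    ∃ γ, IsOptimalPlan b ρ σ γ := by
  obtain ⟨γ, hγ, hmin⟩ := LowerSemicontinuousOn.exists_isMinOn
    (s := {γ : ProbabilityMeasure (X × X) | (γ : Measure (X × X)) ∈ plans ρ σ})
    ⟨(⟨ρ.prod σ, inferInstance⟩ : ProbabilityMeasure (X × X)), prod_mem_plans⟩
    isCompact_setOf_mem_plans ((lowerSemicontinuous_lintegral_coe hb).lowerSemicontinuousOn _)
  refine ⟨γ, hγ, le_antisymm (le_iInf₂ fun γ' hγ' => ?_) (transportValue_le hγ)⟩
  exact hmin (show (⟨γ', hγ'.1⟩ : ProbabilityMeasure (X × X)) ∈ _ from hγ')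

end Plans

/-! ### The infimal cost and its minimizers -/

section MidCost

variable {X : Type*} {c₀ c₁ : X × X → ℝ≥0} {S K : Set X}

theorem midCost_le {x : X} (hx : x ∈ S) (p : X × X) :
    midCost c₀ c₁ S p ≤ c₀ (p.1, x) + c₁ (x, p.2) :=
  ciInf_le (OrderBot.bddBelow _) (⟨x, hx⟩ : S)

theorem midCost_eq_of_mem_midArgmin {x x₀ x₁ : X} (hx : x ∈ midArgmin c₀ c₁ S x₀ x₁) :
    midCost c₀ c₁ S (x₀, x₁) = c₀ (x₀, x) + c₁ (x, x₁) := by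
  have : Nonempty S := ⟨⟨x, hx.1⟩⟩
  exact le_antisymm (midCost_le hx.1 _) (le_ciInf fun y => hx.2 y.2)

theorem midCost_eq_iff_mem_midArgmin {x x₀ x₁ : X} (hx : x ∈ S) :
    midCost c₀ c₁ S (x₀, x₁) = c₀ (x₀, x) + c₁ (x, x₁) ↔ x ∈ midArgmin c₀ c₁ S x₀ x₁ :=
  ⟨fun h => ⟨hx, fun _ hy => h.ge.trans (midCost_le hy (x₀, x₁))⟩, midCost_eq_of_mem_midArgmin⟩

/-- A minimizer over `S` that lies in `K` also minimizes over `K`. -/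
theorem midCost_eq_midCost_of_subset {x₀ x₁ : X} (hKS : K ⊆ S)
    (hne : (midArgmin c₀ c₁ S x₀ x₁).Nonempty) (hsub : midArgmin c₀ c₁ S x₀ x₁ ⊆ K) :
    midCost c₀ c₁ S (x₀, x₁) = midCost c₀ c₁ K (x₀, x₁) := by
  obtain ⟨x, hx⟩ := hne
  rw [midCost_eq_of_mem_midArgmin hx,
    midCost_eq_of_mem_midArgmin (S := K) ⟨hsub hx, hx.2.on_subset hKS⟩]

variable [TopologicalSpace X]

theorem continuous_midCost (hc₀ : Continuous c₀) (hc₁ : Continuous c₁) (hK : IsCompact K) :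
    Continuous (midCost c₀ c₁ K) := by
  have h := hK.continuous_sInf (f := fun (p : X × X) x => c₀ (p.1, x) + c₁ (x, p.2))
    (by simp only [Function.HasUncurry.uncurry, id]; fun_prop)
  simp only [sInf_image'] at h
  exact h

theorem midArgmin_nonempty (hc₀ : Continuous c₀) (hc₁ : Continuous c₁) (hK : IsCompact K)
    (hne : K.Nonempty) (x₀ x₁ : X) : (midArgmin c₀ c₁ K x₀ x₁).Nonempty :=
  hK.exists_isMinOn hne (by fun_prop : Continuous fun y => c₀ (x₀, y) + c₁ (y, x₁)).continuousOn

theorem exists_measurable_mem_midArgmin [TopologicalSpace.MetrizableSpace X] [MeasurableSpace X]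
    [BorelSpace X] [SecondCountableTopology X] (hc₀ : Continuous c₀) (hc₁ : Continuous c₁)
    (hK : IsCompact K) (hne : K.Nonempty) :
    ∃ T : X × X → X, Measurable T ∧ ∀ p, T p ∈ midArgmin c₀ c₁ K p.1 p.2 := by
  have : CompactSpace K := isCompact_iff_compactSpace.mp hK
  have : Nonempty K := hne.to_subtype
  obtain ⟨T, hT, hmin⟩ := exists_measurable_forall_le
    (F := fun q : (X × X) × K => c₀ (q.1.1, (q.2 : X)) + c₁ ((q.2 : X), q.1.2)) (by fun_prop)
  exact ⟨fun p => T p, measurable_subtype_coe.comp hT,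
    fun p => ⟨(T p).2, fun y hy => hmin p ⟨y, hy⟩⟩⟩

end MidCost

/-! ### Comparing the interpolation problem with transport for the infimal cost -/

section Interpolation

variable {X : Type*} [TopologicalSpace X] [PolishSpace X] [MeasurableSpace X]
  {μ₀ μ μ₁ : Measure X} {c₀ c₁ c : X × X → ℝ≥0} {S K : Set X}

theorem ae_mem_support_of_mem_plans {γ : Measure (X × X)} (hγ : γ ∈ plans μ₀ μ₁) :
    ∀ᵐ p ∂γ, p ∈ μ₀.support ×ˢ μ₁.support := by
  obtain ⟨-, rfl, rfl⟩ := hγ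
  filter_upwards [ae_of_ae_map measurable_fst.aemeasurable (Measure.support_mem_ae),
    ae_of_ae_map measurable_snd.aemeasurable (Measure.support_mem_ae)] with p h₁ h₂
  exact ⟨h₁, h₂⟩

theorem ae_mem_of_mem_plans₃ {γ : Measure (X × X × X)} (hγ : γ ∈ plans₃ μ₀ μ μ₁)
    (hμ : μ ∈ probsOn S) :
    ∀ᵐ p ∂γ, p.1 ∈ μ₀.support ∧ p.2.1 ∈ S ∧ p.2.2 ∈ μ₁.support := by
  obtain ⟨hp, rfl, rfl, rfl⟩ := hγ
  filter_upwards [ae_of_ae_map (by fun_prop) (Measure.support_mem_ae (μ := γ.map fun p => p.1)),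
    ae_of_ae_map (by fun_prop) (mem_ae_iff.mpr hμ.2),
    ae_of_ae_map (by fun_prop) (Measure.support_mem_ae (μ := γ.map fun p => p.2.2))]
    with p h₁ h₂ h₃
  exact ⟨h₁, h₂, h₃⟩

/-- The cost is bounded on the compact product of supports, which carries the product plan.
Finiteness is what turns equal integrals into almost everywhere equality later. -/
theorem transportValue_ne_top [IsProbabilityMeasure μ₀] [IsProbabilityMeasure μ₁]
    (hs₀ : IsCompact μ₀.support) (hs₁ : IsCompact μ₁.support) (hc : Continuous c) :
    transportValue c μ₀ μ₁ ≠ ∞ := by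
  obtain ⟨M, hM⟩ := (hs₀.prod hs₁).bddAbove_image hc.continuousOn
  refine ne_top_of_le_ne_top (b := (M : ℝ≥0∞)) ENNReal.coe_ne_top
    ((transportValue_le prod_mem_plans).trans ?_)
  have : ∫⁻ p, (c p : ℝ≥0∞) ∂(μ₀.prod μ₁) ≤ ∫⁻ _, (M : ℝ≥0∞) ∂(μ₀.prod μ₁) := by
    refine lintegral_mono_ae ?_
    filter_upwards [ae_mem_support_of_mem_plans prod_mem_plans] with p hp
    exact_mod_cast hM (mem_image_of_mem c hp)
  simpa using this

variable [BorelSpace X]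

theorem lintegral_add_of_glued {γ : Measure (X × X × X)} (hc₀ : Continuous c₀)
    (hc₁ : Continuous c₁) :
    ∫⁻ p, (c₀ p : ℝ≥0∞) ∂(γ.map fun p => (p.1, p.2.1)) +
        ∫⁻ p, (c₁ p : ℝ≥0∞) ∂(γ.map fun p => (p.2.1, p.2.2)) =
      ∫⁻ p, ((c₀ (p.1, p.2.1) + c₁ (p.2.1, p.2.2) : ℝ≥0) : ℝ≥0∞) ∂γ := by
  have h₀ := hc₀.measurable
  have h₁ := hc₁.measurable
  rw [lintegral_map (by fun_prop) (by fun_prop), lintegral_map (by fun_prop) (by fun_prop),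
    ← lintegral_add_left (by fun_prop)]
  simp

theorem transportValue_le_lintegral_plans₃ {γ : Measure (X × X × X)}
    (hc : Continuous c) (hμ : μ ∈ probsOn S) (hγ : γ ∈ plans₃ μ₀ μ μ₁)
    (hle : ∀ x₀ ∈ μ₀.support, ∀ x₁ ∈ μ₁.support, ∀ x ∈ S, c (x₀, x₁) ≤ c₀ (x₀, x) + c₁ (x, x₁)) :
    transportValue c μ₀ μ₁ ≤ ∫⁻ p, (c p : ℝ≥0∞) ∂(γ.map fun p => (p.1, p.2.2)) ∧
    ∫⁻ p, (c p : ℝ≥0∞) ∂(γ.map fun p => (p.1, p.2.2)) =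
      ∫⁻ p, (c (p.1, p.2.2) : ℝ≥0∞) ∂γ ∧
    ∀ᵐ p ∂γ, (c (p.1, p.2.2) : ℝ≥0∞) ≤
      ((c₀ (p.1, p.2.1) + c₁ (p.2.1, p.2.2) : ℝ≥0) : ℝ≥0∞) := by
  have := hc.measurable
  refine ⟨transportValue_le (map_mem_plans_of_mem_plans₃ hγ),
    lintegral_map (by fun_prop) (by fun_prop), ?_⟩
  filter_upwards [ae_mem_of_mem_plans₃ hγ hμ] with p hp
  exact_mod_cast hle _ hp.1 _ hp.2.2 _ hp.2.1

theorem transportValue_le_interpolationCost [IsProbabilityMeasure μ₀] [IsProbabilityMeasure μ₁]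
    (hc₀ : Continuous c₀) (hc₁ : Continuous c₁) (hc : Continuous c) (hμ : μ ∈ probsOn S)
    (hle : ∀ x₀ ∈ μ₀.support, ∀ x₁ ∈ μ₁.support, ∀ x ∈ S, c (x₀, x₁) ≤ c₀ (x₀, x) + c₁ (x, x₁)) :
    transportValue c μ₀ μ₁ ≤ interpolationCost c₀ c₁ μ₀ μ₁ μ := by
  have := hμ.1
  obtain ⟨γ₀, h₀⟩ := exists_isOptimalPlan (ρ := μ₀) (σ := μ) hc₀
  obtain ⟨γ₁, h₁⟩ := exists_isOptimalPlan (ρ := μ) (σ := μ₁) hc₁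
  obtain ⟨γ, hγ, e₀, e₁⟩ := exists_glued_plan h₀.1 h₁.1
  obtain ⟨hW, hmap, hae⟩ := transportValue_le_lintegral_plans₃ hc hμ hγ hle
  rw [interpolationCost, ← h₀.2, ← h₁.2, ← e₀, ← e₁, lintegral_add_of_glued hc₀ hc₁]
  exact (hW.trans_eq hmap).trans (lintegral_mono_ae hae)

/-- Minimal points between the endpoints of an optimal plan give an interpolating measure. -/
theorem pushforwardOn_mem_probsOn_and_interpolationCost_le {γ : Measure (X × X)}
    (hc₀ : Continuous c₀) (hc₁ : Continuous c₁) (hc : Continuous c) (hS : MeasurableSet S)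
    (hγ : γ ∈ plans μ₀ μ₁)
    {T : ↥(μ₀.support ×ˢ μ₁.support) → X} (hT : Measurable T) (hTS : ∀ p, T p ∈ S)
    (hTc : ∀ p, c p.1 = c₀ (p.1.1, T p) + c₁ (T p, p.1.2)) :
    pushforwardOn T γ ∈ probsOn S ∧
      interpolationCost c₀ c₁ μ₀ μ₁ (pushforwardOn T γ) ≤ ∫⁻ p, (c p : ℝ≥0∞) ∂γ := by
  have hD : MeasurableSet (μ₀.support ×ˢ μ₁.support) :=
    Measure.isClosed_support.measurableSet.prod Measure.isClosed_support.measurableSet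
  set γ' := γ.comap (Subtype.val : ↥(μ₀.support ×ˢ μ₁.support) → X × X) with hγ'
  -- The plan is carried by the product of the supports, so restricting to it loses no mass.
  have hval : γ'.map Subtype.val = γ := by
    rw [hγ', map_comap_subtype_coe hD]
    exact Measure.restrict_eq_self_of_ae_mem (ae_mem_support_of_mem_plans hγ)
  obtain ⟨hp, hfst, hsnd⟩ := hγ
  have hp' : IsProbabilityMeasure γ' := by
    rw [← hval] at hp
    exact Measure.isProbabilityMeasure_of_map Subtype.val
  have hfst₀ : γ'.map (fun p => p.1.1) = μ₀ := by
    refine Eq.trans ?_ hfst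
    conv_rhs => rw [← hval, Measure.map_map measurable_fst measurable_subtype_coe]
    rfl
  have hsnd₁ : γ'.map (fun p => p.1.2) = μ₁ := by
    refine Eq.trans ?_ hsnd
    conv_rhs => rw [← hval, Measure.map_map measurable_snd measurable_subtype_coe]
    rfl
  have h₀ : γ'.map (fun p => (p.1.1, T p)) ∈ plans μ₀ (pushforwardOn T γ) := by
    refine ⟨Measure.isProbabilityMeasure_map (by fun_prop), ?_, ?_⟩
    · rw [Measure.map_map measurable_fst (by fun_prop)]
      exact hfst₀
    · rw [Measure.map_map measurable_snd (by fun_prop)]; rfl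
  have h₁ : γ'.map (fun p => (T p, p.1.2)) ∈ plans (pushforwardOn T γ) μ₁ := by
    refine ⟨Measure.isProbabilityMeasure_map (by fun_prop), ?_, ?_⟩
    · rw [Measure.map_map measurable_fst (by fun_prop)]; rfl
    · rw [Measure.map_map measurable_snd (by fun_prop)]
      exact hsnd₁
  refine ⟨⟨Measure.isProbabilityMeasure_map hT.aemeasurable, ?_⟩, ?_⟩
  · exact mem_ae_iff.mp ((ae_map_iff hT.aemeasurable hS).mpr (.of_forall hTS))
  · refine (add_le_add (transportValue_le h₀) (transportValue_le h₁)).trans_eq ?_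
    have := hc₀.measurable
    have := hc₁.measurable
    have := hc.measurable
    conv_rhs => rw [← hval]
    rw [lintegral_map (by fun_prop) (by fun_prop), lintegral_map (by fun_prop) (by fun_prop),
      lintegral_map (by fun_prop) (by fun_prop), ← lintegral_add_left (by fun_prop)]
    simp [hTc]

theorem interpolationValue_eq_transportValue_and_exists_isInterpolant
    [IsProbabilityMeasure μ₀] [IsProbabilityMeasure μ₁]
    (hc₀ : Continuous c₀) (hc₁ : Continuous c₁) (hK : IsCompact K) (hne : K.Nonempty)
    (hS : IsClosed S) (hKS : K ⊆ S)
    (hle : ∀ x₀ ∈ μ₀.support, ∀ x₁ ∈ μ₁.support, ∀ x ∈ S,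
      midCost c₀ c₁ K (x₀, x₁) ≤ c₀ (x₀, x) + c₁ (x, x₁)) :
    interpolationValue c₀ c₁ μ₀ μ₁ (probsOn S) = transportValue (midCost c₀ c₁ K) μ₀ μ₁ ∧
    (∃ μ, IsInterpolant c₀ c₁ μ₀ μ₁ (probsOn S) μ) ∧
    ∀ γ, IsOptimalPlan (midCost c₀ c₁ K) μ₀ μ₁ γ →
      ∀ T : ↥(μ₀.support ×ˢ μ₁.support) → X, Measurable T →
        (∀ p, T p ∈ midArgmin c₀ c₁ K p.1.1 p.1.2) →
        IsInterpolant c₀ c₁ μ₀ μ₁ (probsOn S) (pushforwardOn T γ) := by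
  have hc := continuous_midCost hc₀ hc₁ hK
  have hge : transportValue (midCost c₀ c₁ K) μ₀ μ₁ ≤
      interpolationValue c₀ c₁ μ₀ μ₁ (probsOn S) :=
    le_iInf₂ fun μ hμ => transportValue_le_interpolationCost hc₀ hc₁ hc hμ hle
  have hpush : ∀ γ, IsOptimalPlan (midCost c₀ c₁ K) μ₀ μ₁ γ →
      ∀ T : ↥(μ₀.support ×ˢ μ₁.support) → X, Measurable T →
        (∀ p, T p ∈ midArgmin c₀ c₁ K p.1.1 p.1.2) →
        pushforwardOn T γ ∈ probsOn S ∧ interpolationCost c₀ c₁ μ₀ μ₁ (pushforwardOn T γ) ≤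
          transportValue (midCost c₀ c₁ K) μ₀ μ₁ := by
    intro γ hγ T hT hTm
    rw [← hγ.2]
    exact pushforwardOn_mem_probsOn_and_interpolationCost_le hc₀ hc₁ hc hS.measurableSet
      hγ.1 hT
      (fun p => hKS (hTm p).1) (fun p => midCost_eq_of_mem_midArgmin (hTm p))
  have hsol : ∀ γ, IsOptimalPlan (midCost c₀ c₁ K) μ₀ μ₁ γ →
      ∀ T : ↥(μ₀.support ×ˢ μ₁.support) → X, Measurable T →
        (∀ p, T p ∈ midArgmin c₀ c₁ K p.1.1 p.1.2) →
        IsInterpolant c₀ c₁ μ₀ μ₁ (probsOn S) (pushforwardOn T γ) := by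
    intro γ hγ T hT hTm
    obtain ⟨hA, hcost⟩ := hpush γ hγ T hT hTm
    exact ⟨hA, le_antisymm (hcost.trans hge) (iInf₂_le _ hA)⟩
  obtain ⟨γ, hγ⟩ := exists_isOptimalPlan (ρ := μ₀) (σ := μ₁) hc
  obtain ⟨T, hT, hTm⟩ := exists_measurable_mem_midArgmin hc₀ hc₁ hK hne
  have hT' : Measurable fun p : ↥(μ₀.support ×ˢ μ₁.support) => T p.1 :=
    hT.comp measurable_subtype_coe
  have hμ := hsol γ hγ _ hT' fun p => hTm p.1
  refine ⟨le_antisymm ?_ hge, ⟨_, hμ⟩, hsol⟩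
  rw [← hμ.2]
  exact (hpush γ hγ _ hT' fun p => hTm p.1).2

theorem support_plan_of_isInterpolant [IsProbabilityMeasure μ₀] [IsProbabilityMeasure μ₁]
    (hs₀ : IsCompact μ₀.support) (hs₁ : IsCompact μ₁.support)
    (hc₀ : Continuous c₀) (hc₁ : Continuous c₁) (hc : Continuous c) (hS : IsClosed S)
    (hle : ∀ x₀ ∈ μ₀.support, ∀ x₁ ∈ μ₁.support, ∀ x ∈ S, c (x₀, x₁) ≤ c₀ (x₀, x) + c₁ (x, x₁))
    (hμ : μ ∈ probsOn S) (hcost : interpolationCost c₀ c₁ μ₀ μ₁ μ = transportValue c μ₀ μ₁)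
    {γ₀ γ₁ : Measure (X × X)} (h₀ : IsOptimalPlan c₀ μ₀ μ γ₀) (h₁ : IsOptimalPlan c₁ μ μ₁ γ₁)
    {γ : Measure (X × X × X)} (hγ : γ ∈ plans₃ μ₀ μ μ₁)
    (e₀ : γ.map (fun p => (p.1, p.2.1)) = γ₀) (e₁ : γ.map (fun p => (p.2.1, p.2.2)) = γ₁) :
    IsOptimalPlan c μ₀ μ₁ (γ.map fun p => (p.1, p.2.2)) ∧
    (∀ᵐ p ∂γ, p ∈ γ.support) ∧
    ∀ p ∈ γ.support, p.1 ∈ μ₀.support ∧ p.2.1 ∈ S ∧ p.2.2 ∈ μ₁.support ∧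
      c₀ (p.1, p.2.1) + c₁ (p.2.1, p.2.2) = c (p.1, p.2.2) := by
  obtain ⟨hW, hmap, hae⟩ := transportValue_le_lintegral_plans₃ hc hμ hγ hle
  have hsum : ∫⁻ p, ((c₀ (p.1, p.2.1) + c₁ (p.2.1, p.2.2) : ℝ≥0) : ℝ≥0∞) ∂γ =
      transportValue c μ₀ μ₁ := by
    rw [← hcost, interpolationCost, ← h₀.2, ← h₁.2, ← e₀, ← e₁, lintegral_add_of_glued hc₀ hc₁]
  have hle' := lintegral_mono_ae hae
  have hopt := le_antisymm (hmap.trans_le (hle'.trans_eq hsum)) hW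
  -- Optimality of `μ` forces equality in the integrated inequality, and the integral is finite.
  have heq := ae_eq_of_ae_le_of_lintegral_le hae
    (by rw [← hmap, hopt]; exact transportValue_ne_top hs₀ hs₁ hc) (by fun_prop)
    (by rw [hsum, ← hmap, hopt])
  refine ⟨⟨map_mem_plans_of_mem_plans₃ hγ, hopt⟩, Measure.support_mem_ae, ?_⟩
  -- A closed set of full measure contains the support, which upgrades the almost everywhere
  -- identity to a pointwise one.
  have hclosed : IsClosed {p : X × X × X | p.1 ∈ μ₀.support ∧ p.2.1 ∈ S ∧ p.2.2 ∈ μ₁.support ∧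
      c₀ (p.1, p.2.1) + c₁ (p.2.1, p.2.2) = c (p.1, p.2.2)} :=
    (Measure.isClosed_support.preimage (by fun_prop)).inter
      ((hS.preimage (by fun_prop : Continuous fun p : X × X × X => p.2.1)).inter
      ((Measure.isClosed_support.preimage
        (by fun_prop : Continuous fun p : X × X × X => p.2.2)).inter
      (isClosed_eq (by fun_prop) (by fun_prop))))
  refine Measure.support_subset_of_isClosed hclosed ?_
  filter_upwards [ae_mem_of_mem_plans₃ hγ hμ, heq] with p hp hpe
  exact ⟨hp.1, hp.2.1, hp.2.2, by exact_mod_cast hpe.symm⟩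

theorem interpolation_probsOn [IsProbabilityMeasure μ₀] [IsProbabilityMeasure μ₁]
    (hs₀ : IsCompact μ₀.support) (hs₁ : IsCompact μ₁.support)
    (hc₀ : Continuous c₀) (hc₁ : Continuous c₁) (hK : IsCompact K) (hS : IsClosed S)
    (hKS : K ⊆ S)
    (h : ∀ x₀ ∈ μ₀.support, ∀ x₁ ∈ μ₁.support,
      (midArgmin c₀ c₁ S x₀ x₁).Nonempty ∧ midArgmin c₀ c₁ S x₀ x₁ ⊆ K) :
    interpolationValue c₀ c₁ μ₀ μ₁ (probsOn S) = transportValue (midCost c₀ c₁ S) μ₀ μ₁ ∧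
    (∃ γ, IsOptimalPlan (midCost c₀ c₁ S) μ₀ μ₁ γ) ∧
    (∃ μ, IsInterpolant c₀ c₁ μ₀ μ₁ (probsOn S) μ) ∧
    (∀ γ, IsOptimalPlan (midCost c₀ c₁ S) μ₀ μ₁ γ →
      ∀ T : ↥(μ₀.support ×ˢ μ₁.support) → X, Measurable T →
        (∀ p, T p ∈ midArgmin c₀ c₁ K p.1.1 p.1.2) →
        IsInterpolant c₀ c₁ μ₀ μ₁ (probsOn S) (pushforwardOn T γ)) ∧
    (∀ μ, IsInterpolant c₀ c₁ μ₀ μ₁ (probsOn S) μ →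
      μ.support ⊆ K ∧
      (∃ γ₀, IsOptimalPlan c₀ μ₀ μ γ₀) ∧ (∃ γ₁, IsOptimalPlan c₁ μ μ₁ γ₁) ∧
      ∀ γ₀ γ₁, IsOptimalPlan c₀ μ₀ μ γ₀ → IsOptimalPlan c₁ μ μ₁ γ₁ →
        ∃ γ ∈ plans₃ μ₀ μ μ₁,
          γ.map (fun p => (p.1, p.2.1)) = γ₀ ∧ γ.map (fun p => (p.2.1, p.2.2)) = γ₁ ∧
          IsOptimalPlan (midCost c₀ c₁ S) μ₀ μ₁ (γ.map (fun p => (p.1, p.2.2))) ∧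
          ∀ p ∈ γ.support,
            c₀ (p.1, p.2.1) + c₁ (p.2.1, p.2.2) = midCost c₀ c₁ S (p.1, p.2.2)) := by
  have hmid : ∀ x₀ ∈ μ₀.support, ∀ x₁ ∈ μ₁.support,
      midCost c₀ c₁ S (x₀, x₁) = midCost c₀ c₁ K (x₀, x₁) := fun x₀ h₀ x₁ h₁ =>
    midCost_eq_midCost_of_subset hKS (h x₀ h₀ x₁ h₁).1 (h x₀ h₀ x₁ h₁).2
  have hcongr : ∀ γ ∈ plans μ₀ μ₁, midCost c₀ c₁ S =ᵐ[γ] midCost c₀ c₁ K := by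
    intro γ hγ
    filter_upwards [ae_mem_support_of_mem_plans hγ] with p hp
    exact hmid _ hp.1 _ hp.2
  have hne : K.Nonempty := by
    obtain ⟨x₀, h₀⟩ := Measure.nonempty_support (IsProbabilityMeasure.ne_zero μ₀)
    obtain ⟨x₁, h₁⟩ := Measure.nonempty_support (IsProbabilityMeasure.ne_zero μ₁)
    exact (h x₀ h₀ x₁ h₁).1.mono (h x₀ h₀ x₁ h₁).2
  have hle : ∀ x₀ ∈ μ₀.support, ∀ x₁ ∈ μ₁.support, ∀ x ∈ S,
      midCost c₀ c₁ K (x₀, x₁) ≤ c₀ (x₀, x) + c₁ (x, x₁) := fun x₀ h₀ x₁ h₁ x hx =>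
    (hmid x₀ h₀ x₁ h₁).ge.trans (midCost_le hx (x₀, x₁))
  have hc := continuous_midCost hc₀ hc₁ hK
  simp only [isOptimalPlan_congr hcongr, transportValue_congr hcongr]
  obtain ⟨hval, hex, hpush⟩ :=
    interpolationValue_eq_transportValue_and_exists_isInterpolant hc₀ hc₁ hK hne hS hKS hle
  refine ⟨hval, exists_isOptimalPlan hc, hex, hpush, fun μ ⟨hμ, hμc⟩ => ?_⟩
  have hglue : ∀ γ₀ γ₁, IsOptimalPlan c₀ μ₀ μ γ₀ → IsOptimalPlan c₁ μ μ₁ γ₁ →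
      ∃ γ ∈ plans₃ μ₀ μ μ₁,
        γ.map (fun p => (p.1, p.2.1)) = γ₀ ∧ γ.map (fun p => (p.2.1, p.2.2)) = γ₁ ∧
        IsOptimalPlan (midCost c₀ c₁ K) μ₀ μ₁ (γ.map (fun p => (p.1, p.2.2))) ∧
        (∀ p ∈ γ.support,
          c₀ (p.1, p.2.1) + c₁ (p.2.1, p.2.2) = midCost c₀ c₁ S (p.1, p.2.2)) ∧
        ∀ᵐ p ∂γ, p.2.1 ∈ K := by
    intro γ₀ γ₁ h₀ h₁
    obtain ⟨γ, hγ, e₀, e₁⟩ := exists_glued_plan h₀.1 h₁.1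
    obtain ⟨hopt, hae, hsupp⟩ := support_plan_of_isInterpolant hs₀ hs₁ hc₀ hc₁ hc hS hle hμ
      (hμc.trans hval) h₀ h₁ hγ e₀ e₁
    have hsum : ∀ p ∈ γ.support,
        c₀ (p.1, p.2.1) + c₁ (p.2.1, p.2.2) = midCost c₀ c₁ S (p.1, p.2.2) := fun p hp => by
      obtain ⟨hp₀, -, hp₁, hpe⟩ := hsupp p hp
      rw [hpe, hmid _ hp₀ _ hp₁]
    refine ⟨γ, hγ, e₀, e₁, hopt, hsum, hae.mono fun p hp => ?_⟩
    obtain ⟨hp₀, hpS, hp₁, -⟩ := hsupp p hp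
    -- Equality of costs makes the midpoint a minimizer over `S`, hence a point of `K`; this gives
    -- the support bound for `μ`.
    exact (h _ hp₀ _ hp₁).2 ((midCost_eq_iff_mem_midArgmin hpS).1 (hsum p hp).symm)
  have := hμ.1
  obtain ⟨γ₀, h₀⟩ := exists_isOptimalPlan (ρ := μ₀) (σ := μ) hc₀
  obtain ⟨γ₁, h₁⟩ := exists_isOptimalPlan (ρ := μ) (σ := μ₁) hc₁
  refine ⟨?_, ⟨γ₀, h₀⟩, ⟨γ₁, h₁⟩, fun γ₀ γ₁ h₀ h₁ => ?_⟩
  · obtain ⟨γ, hγ, -, -, -, -, hK'⟩ := hglue γ₀ γ₁ h₀ h₁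
    refine Measure.support_subset_of_isClosed hK.isClosed ?_
    rw [← hγ.2.2.1]
    exact (ae_map_iff (by fun_prop) hK.measurableSet).mpr hK'
  · obtain ⟨γ, hγ, e₀, e₁, hopt, hsum, -⟩ := hglue γ₀ γ₁ h₀ h₁
    exact ⟨γ, hγ, e₀, e₁, hopt, hsum⟩

end Interpolation

end ConstrainedInterpolation

open ConstrainedInterpolation in
theorem mainTheorem1 (d : ℕ) (μ₀ μ₁ : Measure (EuclideanSpace ℝ (Fin d)))
    (hμ₀ : IsProbabilityMeasure μ₀) (hμ₁ : IsProbabilityMeasure μ₁)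
    (hs₀ : IsCompact μ₀.support) (hs₁ : IsCompact μ₁.support)
    (c₀ c₁ : EuclideanSpace ℝ (Fin d) × EuclideanSpace ℝ (Fin d) → ℝ≥0)
    (hc₀ : Continuous c₀) (hc₁ : Continuous c₁)
    (K : Set (EuclideanSpace ℝ (Fin d))) (hK : IsCompact K) :
    -- No constraint, under the coercivity condition.
    ((∀ x₀ ∈ μ₀.support, ∀ x₁ ∈ μ₁.support,
        (midArgmin c₀ c₁ univ x₀ x₁).Nonempty ∧ midArgmin c₀ c₁ univ x₀ x₁ ⊆ K) →
      (interpolationValue c₀ c₁ μ₀ μ₁ (probs _) = transportValue (midCost c₀ c₁ univ) μ₀ μ₁ ∧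
      (∃ γ, IsOptimalPlan (midCost c₀ c₁ univ) μ₀ μ₁ γ) ∧
      (∃ μ, IsInterpolant c₀ c₁ μ₀ μ₁ (probs _) μ) ∧
      (∀ γ, IsOptimalPlan (midCost c₀ c₁ univ) μ₀ μ₁ γ →
        ∀ T : ↥(μ₀.support ×ˢ μ₁.support) → EuclideanSpace ℝ (Fin d), Measurable T →
          (∀ p, T p ∈ midArgmin c₀ c₁ K p.1.1 p.1.2) →
          IsInterpolant c₀ c₁ μ₀ μ₁ (probs _) (pushforwardOn T γ)) ∧
      (∀ μ, IsInterpolant c₀ c₁ μ₀ μ₁ (probs _) μ →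
        μ.support ⊆ K ∧
        (∃ γ₀, IsOptimalPlan c₀ μ₀ μ γ₀) ∧ (∃ γ₁, IsOptimalPlan c₁ μ μ₁ γ₁) ∧
        ∀ γ₀ γ₁, IsOptimalPlan c₀ μ₀ μ γ₀ → IsOptimalPlan c₁ μ μ₁ γ₁ →
          ∃ γ ∈ plans₃ μ₀ μ μ₁,
            γ.map (fun p => (p.1, p.2.1)) = γ₀ ∧ γ.map (fun p => (p.2.1, p.2.2)) = γ₁ ∧
            IsOptimalPlan (midCost c₀ c₁ univ) μ₀ μ₁ (γ.map (fun p => (p.1, p.2.2))) ∧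
            ∀ p ∈ γ.support,
              c₀ (p.1, p.2.1) + c₁ (p.2.1, p.2.2) = midCost c₀ c₁ univ (p.1, p.2.2)))) ∧
    -- Location constraint, without the coercivity condition.
    (K.Nonempty →
      (interpolationValue c₀ c₁ μ₀ μ₁ (probsOn K) = transportValue (midCost c₀ c₁ K) μ₀ μ₁ ∧
      (∃ γ, IsOptimalPlan (midCost c₀ c₁ K) μ₀ μ₁ γ) ∧
      (∃ μ, IsInterpolant c₀ c₁ μ₀ μ₁ (probsOn K) μ) ∧
      (∀ γ, IsOptimalPlan (midCost c₀ c₁ K) μ₀ μ₁ γ →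
        ∀ T : ↥(μ₀.support ×ˢ μ₁.support) → EuclideanSpace ℝ (Fin d), Measurable T →
          (∀ p, T p ∈ midArgmin c₀ c₁ K p.1.1 p.1.2) →
          IsInterpolant c₀ c₁ μ₀ μ₁ (probsOn K) (pushforwardOn T γ)) ∧
      (∀ μ, IsInterpolant c₀ c₁ μ₀ μ₁ (probsOn K) μ →
        μ.support ⊆ K ∧
        (∃ γ₀, IsOptimalPlan c₀ μ₀ μ γ₀) ∧ (∃ γ₁, IsOptimalPlan c₁ μ μ₁ γ₁) ∧
        ∀ γ₀ γ₁, IsOptimalPlan c₀ μ₀ μ γ₀ → IsOptimalPlan c₁ μ μ₁ γ₁ →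
          ∃ γ ∈ plans₃ μ₀ μ μ₁,
            γ.map (fun p => (p.1, p.2.1)) = γ₀ ∧ γ.map (fun p => (p.2.1, p.2.2)) = γ₁ ∧
            IsOptimalPlan (midCost c₀ c₁ K) μ₀ μ₁ (γ.map (fun p => (p.1, p.2.2))) ∧
            ∀ p ∈ γ.support,
              c₀ (p.1, p.2.1) + c₁ (p.2.1, p.2.2) = midCost c₀ c₁ K (p.1, p.2.2)))) := by
  refine ⟨fun h => ?_, fun hne => ?_⟩
  · simpa only [probsOn_univ] using
      interpolation_probsOn hs₀ hs₁ hc₀ hc₁ hK isClosed_univ (subset_univ K) h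
  · exact interpolation_probsOn hs₀ hs₁ hc₀ hc₁ hK hK.isClosed subset_rfl fun x₀ _ x₁ _ =>
      ⟨midArgmin_nonempty hc₀ hc₁ hK hne x₀ x₁, fun _ hx => hx.1⟩
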